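/- A closure space $(X,c)$ is a set with a map $c:\mathcal P(X)\to\mathcal P(X)$ such that $c(\emptyset)=\emptyset$, $A\subseteq c(A)$ and $c(A\cup B)=c(A)\cup c(B)$. A set $U$ is a neighborhood of $x$ if $x\notin c(X\setminus U)$; $A$ is closed if $c(A)=A$, and open if its complement is closed. A map $f$ is continuous if $f(c(A))\subseteq c(f(A))$ for all $A$; a homeomorphism is a bijection continuous in both directions. A subset is connected if it is not a union $U\cup V$ of two non-empty sets with $(c(U)\cap V)\cup(U\cap c(V))=\emptyset$. A subset $A\subseteq X$ carries the closure $S\mapsto A\cap c(S)$; in a product, the sets $U\times V$ with $U,V$ neighborhoods of the coordinates form a local base. An interior cover of $X$ is a family of subsets containing a neighborhood of every point. With $I=[0,1]$ (topological closure), $\pi_1(X,x)$ is the group of continuous loops $I\to X$ at $x$ modulo homotopy rel $\partial I$ (continuous maps $I\times I\to X$), with $[v][w]=[v\star w]$ ($v$ first). $X$ is path-connected if it is non-empty and any two points are joined by a continuous path, and simply connected if moreover $\pi_1(X,x)=1$ for every $x$. A continuous surjection $p:E\to B$ is a covering if (i) there is an interior cover of $B$ such that for each member $U$ there are a closure space $F$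 and a homeomorphism $p^{-1}(U)\to U\times F$ whose first component is $p$; (ii) in every fibre $p^{-1}(b)$, with the subspace closure, each point is both open and closed; (iii) there is an interior cover of $B$ such that $p^{-1}(U)\cong U\times p^{-1}(b)$ for each member $U$ and each $b\in U$. Let a group $G$ act on $E$ from the right, each $g\in G$ acting by a continuous map. The covering $p$ is a right $G$-principal covering if every $x\in E$ has a neighborhood $U$ such that, for all $g\in G$ with $g\neq 1$, $Ug\cap U=\emptyset$ and $Ug\cup U$ is not connected; $p(xg)=p(x)$ for all $x\in E$, $g\in G$; and $G$ acts transitively on each fibre of $p$. **Theorem.** Let $p:E\to B$ be a right $G$-principal covering of closure spaces with $E$ path-connected. Then for each $x\in E$: every loop $v$ in $B$ at $p(x)$ has a unique continuous lift $V:I\to E$ with $V(0)=x$; there is a group homomorphism $\Gamma_x:\pi_1(B,p(x))\to G$ such that $V(1)=x\cdot\Gamma_x([v])^{-1}$ for all such $v$; and the sequence $$1\to\pi_1(E,x)\xrightarrow{p_*}\pi_1(B,p(x))\xrightarrow{\Gamma_x}G\to1$$ is exact. The image of $p_*$ is a normal subgroup. The space $E$ is simply connected if and only if $\Gamma_x$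 is an isomorphism. Consequently, if $E$ is simply connected, then $\pi_1(B,b)\cong G$ for every $b\in B$. -/

import Mathlib

open Set Topology

namespace Cech

/-- A Čech closure structure on `X`: a closure operator that need not be idempotent. -/
class ClosureSpace (X : Type*) where
  cl : Set X → Set X
  cl_empty : cl ∅ = ∅
  subset_cl : ∀ A, A ⊆ cl A
  cl_union : ∀ A B, cl (A ∪ B) = cl A ∪ cl B


section Basic

variable {X Y Z : Type*} [ClosureSpace X] [ClosureSpace Y] [ClosureSpace Z]

theorem cl_mono {A B : Set X} (h : A ⊆ B) : ClosureSpace.cl A ⊆ ClosureSpace.cl B := by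
  rw [← union_eq_self_of_subset_left h, ClosureSpace.cl_union]
  exact subset_union_left

/-- `U` is a neighborhood of the point `x`. -/
def IsNhd (U : Set X) (x : X) : Prop := x ∈ (ClosureSpace.cl Uᶜ)ᶜ

/-- `A` is closed. -/
def IsClosedSet (A : Set X) : Prop := ClosureSpace.cl A = A

/-- `A` is open. -/
def IsOpenSet (A : Set X) : Prop := IsClosedSet Aᶜ

/-- Two subsets are semi-separated. -/
def SemiSeparated (A B : Set X) : Prop :=
  (ClosureSpace.cl A ∩ B) ∪ (A ∩ ClosureSpace.cl B) = ∅

/-- `A` is a connected subset of `X`. -/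
def IsConnectedSet (A : Set X) : Prop :=
  ∀ U V : Set X, A = U ∪ V → SemiSeparated U V → U = ∅ ∨ V = ∅

/-- Every point is both open and closed. -/
def IsDiscrete (X : Type*) [ClosureSpace X] : Prop :=
  ∀ x : X, IsOpenSet ({x} : Set X) ∧ IsClosedSet ({x} : Set X)

/-- An interior cover: every point has a neighborhood in the family. -/
def IsInteriorCover (𝒰 : Set (Set X)) : Prop :=
  ∀ x : X, ∃ U ∈ 𝒰, IsNhd U x

/-- Continuity of a map of closure spaces. -/
def Cont (f : X → Y) : Prop :=
  ∀ A : Set X, f '' ClosureSpace.cl A ⊆ ClosureSpace.cl (f '' A)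

theorem IsNhd.mem {U : Set X} {x : X} (h : IsNhd U x) : x ∈ U := by
  by_contra hx
  exact h (ClosureSpace.subset_cl _ hx)

theorem IsNhd.mono {U V : Set X} {x : X} (h : IsNhd U x) (hUV : U ⊆ V) : IsNhd V x :=
  fun hx => h (cl_mono (compl_subset_compl.2 hUV) hx)

theorem IsNhd.inter {U V : Set X} {x : X} (h : IsNhd U x) (h' : IsNhd V x) :
    IsNhd (U ∩ V) x := by
  unfold IsNhd at *
  rw [compl_inter, ClosureSpace.cl_union]
  rintro (hx | hx)
  exacts [h hx, h' hx]

theorem isNhd_univ (x : X) : IsNhd univ x := by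
  simp [IsNhd, ClosureSpace.cl_empty]

theorem cont_iff_isNhd {f : X → Y} :
    Cont f ↔ ∀ x U, IsNhd U (f x) → IsNhd (f ⁻¹' U) x := by
  constructor
  · intro hf x U hU hx
    refine hU (cl_mono ?_ (hf _ (mem_image_of_mem f hx)))
    rintro _ ⟨y, hy, rfl⟩
    exact hy
  · rintro hf A _ ⟨x, hx, rfl⟩
    by_contra hfx
    have h : IsNhd (f '' A)ᶜ (f x) := by simpa [IsNhd] using hfx
    refine hf x _ h (cl_mono ?_ hx)
    intro a ha hn
    exact hn (mem_image_of_mem f ha)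

theorem Cont.comp {g : Y → Z} {f : X → Y} (hg : Cont g) (hf : Cont f) :
    Cont (fun x => g (f x)) := by
  rw [cont_iff_isNhd] at *
  intro x U hU
  exact hf x _ (hg _ U hU)

/-- The subspace closure structure. -/
instance instSubspace (A : Set X) : ClosureSpace A where
  cl S := Subtype.val ⁻¹' ClosureSpace.cl (Subtype.val '' S)
  cl_empty := by simp [ClosureSpace.cl_empty]
  subset_cl S := fun x hx => ClosureSpace.subset_cl _ (mem_image_of_mem _ hx)
  cl_union S T := by rw [image_union, ClosureSpace.cl_union, preimage_union]

/-- The product closure structure: the products `U ×ˢ V` of neighborhoods of `z.1` and `z.2`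
form a local base at `z`. -/
instance instProd : ClosureSpace (X × Y) where
  cl S := {z | ∀ U V, IsNhd U z.1 → IsNhd V z.2 → ((U ×ˢ V) ∩ S).Nonempty}
  cl_empty := by
    ext z
    refine ⟨fun h => ?_, fun h => absurd h (notMem_empty z)⟩
    obtain ⟨w, -, hw⟩ := h _ _ (isNhd_univ _) (isNhd_univ _)
    exact hw
  subset_cl S := fun z hz U V hU hV => ⟨z, ⟨hU.mem, hV.mem⟩, hz⟩
  cl_union S T := by
    ext z
    constructor
    · intro h
      by_contra hn
      simp only [mem_union, mem_ofPred_eq, not_or, not_forall] at hn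
      obtain ⟨⟨U, V, hU, hV, h1⟩, ⟨U', V', hU', hV', h2⟩⟩ := hn
      obtain ⟨w, ⟨hw1, hw2⟩, hw | hw⟩ := h _ _ (hU.inter hU') (hV.inter hV')
      · exact h1 ⟨w, ⟨hw1.1, hw2.1⟩, hw⟩
      · exact h2 ⟨w, ⟨hw1.2, hw2.2⟩, hw⟩
    · rintro (h | h) U V hU hV
      · exact (h U V hU hV).mono (inter_subset_inter_right _ subset_union_left)
      · exact (h U V hU hV).mono (inter_subset_inter_right _ subset_union_right)

end Basic

/-- The unit interval with its topological closure structure. -/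
instance instUnitInterval : ClosureSpace unitInterval where
  cl := closure
  cl_empty := closure_empty
  subset_cl _ := subset_closure
  cl_union _ _ := closure_union

section TopologicalSource

variable {S T : Type*} [TopologicalSpace S] [TopologicalSpace T] {X Y : Type*} [ClosureSpace X]
  [ClosureSpace Y]

/-- Auxiliary: continuity of a map from a topological space to a closure space. -/
def TCont (f : T → X) : Prop := ∀ t U, IsNhd U (f t) → f ⁻¹' U ∈ 𝓝 t

theorem isNhd_unitInterval {U : Set unitInterval} {t : unitInterval} :
    IsNhd U t ↔ U ∈ 𝓝 t := by
  change t ∈ (closure Uᶜ)ᶜ ↔ _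
  rw [closure_compl, compl_compl, mem_interior_iff_mem_nhds]

theorem isNhd_unitSquare {U : Set (unitInterval × unitInterval)}
    {z : unitInterval × unitInterval} : IsNhd U z ↔ U ∈ 𝓝 z := by
  have h : IsNhd U z ↔ ∃ V W, IsNhd V z.1 ∧ IsNhd W z.2 ∧ V ×ˢ W ⊆ U := by
    change ¬ (∀ V W, IsNhd V z.1 → IsNhd W z.2 → ((V ×ˢ W) ∩ Uᶜ).Nonempty) ↔ _
    push Not
    constructor
    · rintro ⟨V, W, hV, hW, h⟩
      exact ⟨V, W, hV, hW, by rwa [← sdiff_eq, sdiff_eq_empty] at h⟩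
    · rintro ⟨V, W, hV, hW, h⟩
      exact ⟨V, W, hV, hW, by rwa [← sdiff_eq, sdiff_eq_empty]⟩
  rw [h, ← Prod.mk.eta (p := z), mem_nhds_prod_iff]
  simp only [isNhd_unitInterval]
  constructor
  · rintro ⟨V, W, hV, hW, h⟩
    exact ⟨V, hV, W, hW, h⟩
  · rintro ⟨V, hV, W, hW, h⟩
    exact ⟨V, W, hV, hW, h⟩

theorem cont_unitInterval {f : unitInterval → X} : Cont f ↔ TCont f := by
  simp only [cont_iff_isNhd, TCont, isNhd_unitInterval]

theorem cont_unitSquare {f : unitInterval × unitInterval → X} : Cont f ↔ TCont f := by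
  simp only [cont_iff_isNhd, TCont, isNhd_unitSquare]

theorem TCont.comp {f : T → X} (hf : TCont f) {g : S → T} (hg : Continuous g) :
    TCont (fun s => f (g s)) :=
  fun s U hU => hg.continuousAt.preimage_mem_nhds (hf (g s) U hU)

theorem Cont.comp_tcont {h : X → Y} (hh : Cont h) {f : T → X} (hf : TCont f) :
    TCont (fun t => h (f t)) :=
  fun t U hU => hf t _ (cont_iff_isNhd.1 hh _ U hU)

theorem tcont_const (x : X) : TCont (fun _ : T => x) := by
  intro t U hU
  have : (fun _ : T => x) ⁻¹' U = univ := eq_univ_of_forall fun _ => hU.mem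
  rw [this]
  exact Filter.univ_mem

/-- Gluing along a closed cover `{a ≤ 1/2}`, `{1/2 ≤ a}`. -/
theorem tcont_glue {a : T → ℝ} (ha : Continuous a) {f g : T → X} (hf : TCont f) (hg : TCont g)
    (h : ∀ t, a t = 1 / 2 → f t = g t) :
    TCont (fun t => if a t ≤ 1 / 2 then f t else g t) := by
  intro t U hU
  rcases lt_trichotomy (a t) (1 / 2) with hlt | heq | hgt
  · simp only [if_pos hlt.le] at hU
    filter_upwards [hf t U hU, ha.continuousAt.eventually (gt_mem_nhds hlt)] with s hs hs'
    simpa only [mem_preimage, if_pos hs'.le] using hs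
  · simp only [if_pos heq.le] at hU
    have hU' := hU
    rw [h t heq] at hU'
    filter_upwards [hf t U hU, hg t U hU'] with s hs hs'
    simp only [mem_preimage]
    split_ifs
    exacts [hs, hs']
  · simp only [if_neg hgt.not_ge] at hU
    filter_upwards [hg t U hU, ha.continuousAt.eventually (lt_mem_nhds hgt)] with s hs hs'
    simpa only [mem_preimage, if_neg hs'.not_ge] using hs

end TopologicalSource

/-- A path in a closure space from `x` to `y`. -/
structure CPath {X : Type*} [ClosureSpace X] (x y : X) where
  toFun : unitInterval → X
  cont : Cont toFun
  source : toFun 0 = x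
  target : toFun 1 = y

/-- `t ↦ 2 t`, truncated to the unit interval (only used for `t ≤ 1/2`). -/
noncomputable def dbl (t : unitInterval) : unitInterval := projIcc 0 1 zero_le_one (2 * (t : ℝ))

/-- `t ↦ 2 t - 1`, truncated to the unit interval (only used for `1/2 ≤ t`). -/
noncomputable def dbl' (t : unitInterval) : unitInterval := projIcc 0 1 zero_le_one (2 * (t : ℝ) - 1)

theorem continuous_dbl : Continuous dbl :=
  continuous_projIcc.comp (by fun_prop)

theorem continuous_dbl' : Continuous dbl' :=
  continuous_projIcc.comp (by fun_prop)

theorem dbl_zero : dbl 0 = 0 := by simp [dbl, projIcc]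

theorem dbl'_one : dbl' 1 = 1 := by
  apply Subtype.ext
  simp [dbl', projIcc]
  norm_num

theorem dbl_half {t : unitInterval} (h : (t : ℝ) = 1 / 2) : dbl t = 1 := by
  apply Subtype.ext
  simp [dbl, projIcc, h]

theorem dbl'_half {t : unitInterval} (h : (t : ℝ) = 1 / 2) : dbl' t = 0 := by
  apply Subtype.ext
  simp [dbl', projIcc, h]

namespace CPath

variable {X Y : Type*} [ClosureSpace X] [ClosureSpace Y] {x y z w : X}

/-- The constant path. -/
def refl (x : X) : CPath x x where
  toFun _ := x
  cont := cont_unitInterval.2 (tcont_const x)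
  source := rfl
  target := rfl

/-- The reversed path. -/
def symm (f : CPath x y) : CPath y x where
  toFun t := f.toFun (unitInterval.symm t)
  cont := cont_unitInterval.2 ((cont_unitInterval.1 f.cont).comp unitInterval.continuous_symm)
  source := by simpa using f.target
  target := by simpa using f.source

/-- The concatenation `f ⋆ g`: first `f`, then `g`. -/
noncomputable def trans (f : CPath x y) (g : CPath y z) : CPath x z where
  toFun t := if (t : ℝ) ≤ 1 / 2 then f.toFun (dbl t) else g.toFun (dbl' t)
  cont := cont_unitInterval.2 (tcont_glue continuous_subtype_val
    ((cont_unitInterval.1 f.cont).comp continuous_dbl)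
    ((cont_unitInterval.1 g.cont).comp continuous_dbl')
    (fun t ht => by rw [dbl_half ht, dbl'_half ht, f.target, g.source]))
  source := by simp [dbl_zero, f.source]
  target := by
    have : ¬ ((1 : unitInterval) : ℝ) ≤ 1 / 2 := by norm_num
    simp only [if_neg this, dbl'_one, g.target]

/-- The image of a path under a continuous map. -/
def map (f : CPath x y) (h : X → Y) (hh : Cont h) : CPath (h x) (h y) where
  toFun t := h (f.toFun t)
  cont := hh.comp f.cont
  source := by rw [f.source]
  target := by rw [f.target]

/-- Homotopy of paths relative to the end points. -/
def Homotopic (f g : CPath x y) : Prop :=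
  ∃ H : unitInterval × unitInterval → X, Cont H ∧
    (∀ s, H (s, 0) = f.toFun s) ∧ (∀ s, H (s, 1) = g.toFun s) ∧
    (∀ t, H (0, t) = x) ∧ (∀ t, H (1, t) = y)

theorem Homotopic.refl (f : CPath x y) : Homotopic f f :=
  ⟨fun z => f.toFun z.1, cont_unitSquare.2 ((cont_unitInterval.1 f.cont).comp continuous_fst),
    fun _ => rfl, fun _ => rfl, fun _ => f.source, fun _ => f.target⟩

theorem Homotopic.symm {f g : CPath x y} (h : Homotopic f g) : Homotopic g f := by
  obtain ⟨H, hH, h0, h1, hx, hy⟩ := h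
  refine ⟨fun z => H (z.1, unitInterval.symm z.2), cont_unitSquare.2
    ((cont_unitSquare.1 hH).comp (by fun_prop)), fun s => by simpa using h1 s,
    fun s => by simpa using h0 s, fun t => hx _, fun t => hy _⟩

theorem Homotopic.trans {f g k : CPath x y} (h : Homotopic f g) (h' : Homotopic g k) :
    Homotopic f k := by
  obtain ⟨H, hH, h0, h1, hx, hy⟩ := h
  obtain ⟨K, hK, k0, k1, kx, ky⟩ := h'
  have n1 : ¬ ((1 : unitInterval) : ℝ) ≤ 1 / 2 := by norm_num
  refine ⟨fun z => if (z.2 : ℝ) ≤ 1 / 2 then H (z.1, dbl z.2) else K (z.1, dbl' z.2),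
    cont_unitSquare.2 (tcont_glue (a := fun z => (z.2 : ℝ)) (by fun_prop)
      ((cont_unitSquare.1 hH).comp
        (continuous_fst.prodMk (continuous_dbl.comp continuous_snd)))
      ((cont_unitSquare.1 hK).comp
        (continuous_fst.prodMk (continuous_dbl'.comp continuous_snd))) ?_), ?_, ?_, ?_, ?_⟩
  · intro t ht
    simp only [Function.comp_apply, dbl_half ht, dbl'_half ht, h1, k0]
  · intro s
    simp [dbl_zero, h0]
  · intro s
    simp only [if_neg n1, dbl'_one, k1]
  · intro t
    simp only [hx, kx, ite_self]
  · intro t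
    simp only [hy, ky, ite_self]

theorem Homotopic.concat {f f' : CPath x y} {g g' : CPath y z} (h : Homotopic f f')
    (h' : Homotopic g g') : Homotopic (f.trans g) (f'.trans g') := by
  obtain ⟨H, hH, h0, h1, hx, hy⟩ := h
  obtain ⟨K, hK, k0, k1, kx, ky⟩ := h'
  have n1 : ¬ ((1 : unitInterval) : ℝ) ≤ 1 / 2 := by norm_num
  refine ⟨fun z => if (z.1 : ℝ) ≤ 1 / 2 then H (dbl z.1, z.2) else K (dbl' z.1, z.2),
    cont_unitSquare.2 (tcont_glue (a := fun z => (z.1 : ℝ)) (by fun_prop)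
      ((cont_unitSquare.1 hH).comp
        ((continuous_dbl.comp continuous_fst).prodMk continuous_snd))
      ((cont_unitSquare.1 hK).comp
        ((continuous_dbl'.comp continuous_fst).prodMk continuous_snd)) ?_), ?_, ?_, ?_, ?_⟩
  · intro t ht
    simp only [Function.comp_apply, dbl_half ht, dbl'_half ht, hy, kx]
  · intro s
    simp only [h0, k0, CPath.trans]
  · intro s
    simp only [h1, k1, CPath.trans]
  · intro t
    simp [dbl_zero, hx]
  · intro t
    simp only [if_neg n1, dbl'_one, ky]

theorem Homotopic.map {f g : CPath x y} (h : Homotopic f g) (k : X → Y) (hk : Cont k) :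
    Homotopic (f.map k hk) (g.map k hk) := by
  obtain ⟨H, hH, h0, h1, hx, hy⟩ := h
  exact ⟨fun z => k (H z), hk.comp hH, fun s => congrArg k (h0 s), fun s => congrArg k (h1 s),
    fun t => congrArg k (hx t), fun t => congrArg k (hy t)⟩

/-- Two reparametrizations of one map of the interval, with equal end points, are homotopic. -/
theorem homotopic_of_reparam {F : unitInterval → X} (hF : Cont F) {α β : unitInterval → unitInterval}
    (hα : Continuous α) (hβ : Continuous β) (h0 : α 0 = β 0) (h1 : α 1 = β 1)
    (f g : CPath x y) (hf : ∀ s, f.toFun s = F (α s)) (hg : ∀ s, g.toFun s = F (β s)) :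
    Homotopic f g := by
  let m : unitInterval × unitInterval → unitInterval := fun z =>
    projIcc 0 1 zero_le_one ((1 - (z.2 : ℝ)) * (α z.1 : ℝ) + (z.2 : ℝ) * (β z.1 : ℝ))
  have hm : Continuous m := continuous_projIcc.comp (by fun_prop)
  have e : ∀ (a : unitInterval) (r : ℝ), r = a → projIcc 0 1 zero_le_one r = a := by
    rintro a _ rfl
    exact projIcc_val _ a
  refine ⟨fun z => F (m z), cont_unitSquare.2 ((cont_unitInterval.1 hF).comp hm),
    ?_, ?_, ?_, ?_⟩
  · intro s
    rw [hf]
    exact congrArg F (e _ _ (by simp))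
  · intro s
    rw [hg]
    exact congrArg F (e _ _ (by simp))
  · intro t
    rw [← f.source, hf]
    exact congrArg F (e _ _ (by simp only [← h0]; ring))
  · intro t
    rw [← f.target, hf]
    exact congrArg F (e _ _ (by simp only [← h1]; ring))

instance instSetoid (x y : X) : Setoid (CPath x y) :=
  ⟨Homotopic, Homotopic.refl, Homotopic.symm, Homotopic.trans⟩

theorem trans_of_le (f : CPath x y) (g : CPath y z) {t : unitInterval} (h : (t : ℝ) ≤ 1 / 2) :
    (f.trans g).toFun t = f.toFun (dbl t) := if_pos h

theorem trans_of_ge (f : CPath x y) (g : CPath y z) {t : unitInterval} (h : 1 / 2 ≤ (t : ℝ)) :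
    (f.trans g).toFun t = g.toFun (dbl' t) := by
  rcases h.eq_or_lt with h | h
  · rw [trans_of_le f g h.ge, dbl_half h.symm, dbl'_half h.symm, f.target, g.source]
  · exact if_neg h.not_ge

theorem homotopic_refl_trans (f : CPath x y) : Homotopic ((CPath.refl x).trans f) f := by
  refine homotopic_of_reparam f.cont continuous_dbl' continuous_id ?_ dbl'_one _ _ ?_
    (fun _ => rfl)
  · apply Subtype.ext
    simp [dbl', projIcc]
  · intro s
    rcases le_total (s : ℝ) (1 / 2) with h | h
    · rw [trans_of_le _ _ h]
      have : dbl' s = 0 := projIcc_of_le_left _ (by linarith)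
      rw [this, f.source]
      rfl
    · rw [trans_of_ge _ _ h]

theorem homotopic_trans_refl (f : CPath x y) : Homotopic (f.trans (CPath.refl y)) f := by
  refine homotopic_of_reparam f.cont continuous_dbl continuous_id dbl_zero ?_ _ _ ?_
    (fun _ => rfl)
  · apply Subtype.ext
    simp [dbl, projIcc]
  · intro s
    rcases le_total (s : ℝ) (1 / 2) with h | h
    · rw [trans_of_le _ _ h]
    · rw [trans_of_ge _ _ h]
      have : dbl s = 1 := projIcc_of_right_le _ (by linarith)
      rw [this, f.target]
      rfl

theorem homotopic_trans_symm (f : CPath x y) : Homotopic (f.trans f.symm) (CPath.refl x) := by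
  refine homotopic_of_reparam f.cont
    (α := fun t => projIcc 0 1 zero_le_one (min (2 * (t : ℝ)) (2 - 2 * (t : ℝ))))
    (β := fun _ => 0) (continuous_projIcc.comp (by fun_prop)) continuous_const ?_ ?_ _ _ ?_
    (fun _ => f.source.symm)
  · exact projIcc_of_le_left _ (by simp)
  · exact projIcc_of_le_left _ (by simp)
  · intro s
    rcases le_total (s : ℝ) (1 / 2) with h | h
    · rw [trans_of_le _ _ h, min_eq_left (by linarith)]
      rfl
    · rw [trans_of_ge _ _ h, min_eq_right (by linarith)]
      change f.toFun _ = f.toFun _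
      congr 1
      apply Subtype.ext
      have h1 := s.2.1
      have h2 := s.2.2
      rw [unitInterval.coe_symm_eq, dbl', projIcc_of_mem _ ⟨by linarith, by linarith⟩,
        projIcc_of_mem _ ⟨by linarith, by linarith⟩]
      ring

theorem symm_symm (f : CPath x y) : f.symm.symm = f := by
  obtain ⟨f, hf, h0, h1⟩ := f
  simp [CPath.symm]

theorem homotopic_symm_trans (f : CPath x y) : Homotopic (f.symm.trans f) (CPath.refl y) := by
  have h := homotopic_trans_symm f.symm
  rwa [symm_symm] at h

theorem homotopic_assoc (f : CPath x y) (g : CPath y z) (k : CPath z w) :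
    Homotopic ((f.trans g).trans k) (f.trans (g.trans k)) := by
  have c1 : ∀ {t : unitInterval}, (t : ℝ) ≤ 1 / 2 → (dbl t : ℝ) = 2 * t := fun {t} h => by
    have h1 := t.2.1
    rw [dbl, projIcc_of_mem _ ⟨by linarith, by linarith⟩]
  have c2 : ∀ {t : unitInterval}, 1 / 2 ≤ (t : ℝ) → (dbl' t : ℝ) = 2 * t - 1 := fun {t} h => by
    have h1 := t.2.2
    rw [dbl', projIcc_of_mem _ ⟨by linarith, by linarith⟩]
  let b : unitInterval → ℝ := fun t => max ((t : ℝ) / 2) (max ((t : ℝ) - 1 / 4) (2 * (t : ℝ) - 1))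
  let β : unitInterval → unitInterval := fun t => projIcc 0 1 zero_le_one (b t)
  have hb : ∀ t, (β t : ℝ) = b t := fun t => by
    have h1 := t.2.1
    have h2 := t.2.2
    have : b t ∈ Icc (0 : ℝ) 1 := by
      constructor
      · exact le_max_of_le_left (by linarith)
      · exact max_le (by linarith) (max_le (by linarith) (by linarith))
    change ((projIcc 0 1 zero_le_one (b t) : unitInterval) : ℝ) = b t
    rw [projIcc_of_mem _ this]
  refine homotopic_of_reparam ((f.trans g).trans k).cont continuous_id (β := β)
    (continuous_projIcc.comp (by fun_prop)) ?_ ?_ _ _ (fun _ => rfl) ?_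
  · apply Subtype.ext
    rw [hb]
    norm_num [b]
  · apply Subtype.ext
    rw [hb]
    norm_num [b]
  · intro s
    rcases le_total (s : ℝ) (1 / 2) with h | h
    · have e : (β s : ℝ) = s / 2 := by
        rw [hb]
        exact max_eq_left (max_le (by linarith) (by linarith))
      have e1 : (dbl (β s) : ℝ) = s := by
        rw [c1 (by linarith), e]
        ring
      rw [trans_of_le _ _ h, trans_of_le _ _ (by linarith), trans_of_le _ _ (by linarith),
        Subtype.ext e1]
    · rw [trans_of_ge _ _ h]
      have d := c2 h
      rcases le_total (s : ℝ) (3 / 4) with h' | h'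
      · have e : (β s : ℝ) = s - 1 / 4 := by
          rw [hb]
          exact (max_eq_right (le_max_of_le_left (by linarith))).trans
            (max_eq_left (by linarith))
        have e1 : (dbl (β s) : ℝ) = 2 * s - 1 / 2 := by
          rw [c1 (by linarith), e]
          ring
        rw [trans_of_le _ _ (by linarith), trans_of_le _ _ (by linarith),
          trans_of_ge _ _ (by linarith)]
        congr 1
        apply Subtype.ext
        rw [c1 (t := dbl' s) (by linarith), c2 (t := dbl (β s)) (by linarith)]
        linarith
      · have e : (β s : ℝ) = 2 * s - 1 := by
          rw [hb]
          exact (max_eq_right (le_max_of_le_right (by linarith))).trans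
            (max_eq_right (by linarith))
        rw [trans_of_ge _ _ (by linarith), trans_of_ge _ _ (by linarith)]
        congr 2
        apply Subtype.ext
        linarith

theorem map_trans (f : CPath x y) (g : CPath y z) (h : X → Y) (hh : Cont h) :
    (f.trans g).map h hh = (f.map h hh).trans (g.map h hh) := by
  simp only [CPath.map, CPath.trans, CPath.mk.injEq]
  funext t
  split_ifs <;> rfl

end CPath

section FundamentalGroup

variable {X Y : Type*} [ClosureSpace X] [ClosureSpace Y]

/-- The fundamental group: loops at `x` up to homotopy relative to the end points. -/
def FundGroup (X : Type*) [ClosureSpace X] (x : X) : Type _ :=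
  Quotient (CPath.instSetoid x x)

/-- The class of a loop. -/
def FundGroup.mk {x : X} (v : CPath x x) : FundGroup X x := Quotient.mk _ v

/-- The group structure `[v] * [w] = [v ⋆ w]`. -/
noncomputable instance instGroupFundGroup (x : X) : Group (FundGroup X x) where
  mul := Quotient.map₂ CPath.trans fun _ _ h _ _ h' => CPath.Homotopic.concat h h'
  one := FundGroup.mk (CPath.refl x)
  inv := Quotient.map CPath.symm (by
    rintro f g ⟨H, hH, h0, h1, hx, hy⟩
    exact ⟨fun z => H (unitInterval.symm z.1, z.2),
      cont_unitSquare.2 ((cont_unitSquare.1 hH).comp (by fun_prop)),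
      fun s => h0 _, fun s => h1 _, fun t => by simpa using hy t, fun t => by simpa using hx t⟩)
  mul_assoc := by
    rintro ⟨a⟩ ⟨b⟩ ⟨c⟩
    exact Quotient.sound (CPath.homotopic_assoc a b c)
  one_mul := by
    rintro ⟨a⟩
    exact Quotient.sound (CPath.homotopic_refl_trans a)
  mul_one := by
    rintro ⟨a⟩
    exact Quotient.sound (CPath.homotopic_trans_refl a)
  inv_mul_cancel := by
    rintro ⟨a⟩
    exact Quotient.sound (CPath.homotopic_symm_trans a)

/-- The induced homomorphism `f_*`, `[v] ↦ [f ∘ v]`. -/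
noncomputable def FundGroup.map (f : X → Y) (hf : Cont f) (x : X) : FundGroup X x →* FundGroup Y (f x) :=
  MonoidHom.mk' (Quotient.map (fun v => v.map f hf) fun _ _ h => CPath.Homotopic.map h f hf) (by
    rintro ⟨a⟩ ⟨b⟩
    exact congrArg (Quotient.mk _) (CPath.map_trans a b f hf))

/-- Path-connectedness. -/
def PathConn (X : Type*) [ClosureSpace X] : Prop :=
  Nonempty X ∧ ∀ x y : X, Nonempty (CPath x y)

/-- Simple connectedness: path-connected with trivial fundamental groups. -/
def SimplyConn (X : Type*) [ClosureSpace X] : Prop :=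
  PathConn X ∧ ∀ x : X, Subsingleton (FundGroup X x)

end FundamentalGroup

section Covering

universe u v w

variable {E : Type u} {B : Type v} [ClosureSpace E] [ClosureSpace B]

/-- `p` is trivial over `U` with fibre `F`: there is a homeomorphism `φ : p⁻¹(U) → U × F` whose
first component is `p`. -/
def IsTrivialOver (p : E → B) (U : Set B) (F : Type u) [ClosureSpace F] : Prop :=
  ∃ φ : ↥(p ⁻¹' U) ≃ ↥U × F, Cont φ ∧ Cont φ.symm ∧ ∀ e, ((φ e).1 : B) = p e

/-- Local triviality: `p` is trivial over each member of some interior cover. -/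
def IsLocallyTrivial (p : E → B) : Prop :=
  Cont p ∧ Function.Surjective p ∧ ∃ 𝒰 : Set (Set B), IsInteriorCover 𝒰 ∧
    ∀ U ∈ 𝒰, ∃ (F : Type u) (_ : ClosureSpace F), IsTrivialOver p U F

/-- Covering maps: locally trivial, with discrete fibres, and such that the members of some interior
cover satisfy `p⁻¹(U) ≅ U × p⁻¹(b)` for `b ∈ U`. -/
structure IsCovering (p : E → B) : Prop where
  locallyTrivial : IsLocallyTrivial p
  discrete : ∀ b : B, IsDiscrete ↥(p ⁻¹' {b})
  homeo : ∃ 𝒰 : Set (Set B), IsInteriorCover 𝒰 ∧ ∀ U ∈ 𝒰, ∀ b ∈ U,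
    ∃ φ : ↥(p ⁻¹' U) ≃ ↥U × ↥(p ⁻¹' {b}), Cont φ ∧ Cont φ.symm

variable (G : Type w) [Group G] [MulAction Gᵐᵒᵖ E]

/-- A right action of `G` on `E` (a left action of the opposite group; `x g` is
`MulOpposite.op g • x`) by continuous maps is totally discontinuous if every point has a
neighborhood `U` such that for all `g ≠ 1` the sets `U g` and `U` are disjoint and `U g ∪ U` is not
connected. -/
structure IsTotallyDiscontinuous (E : Type u) [ClosureSpace E] [MulAction Gᵐᵒᵖ E] : Prop where
  cont : ∀ g : G, Cont fun x : E => MulOpposite.op g • x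
  exists_nhd : ∀ x : E, ∃ U : Set E, IsNhd U x ∧ ∀ g : G, g ≠ 1 →
    ((fun y => MulOpposite.op g • y) '' U) ∩ U = ∅ ∧
      ¬ IsConnectedSet (((fun y => MulOpposite.op g • y) '' U) ∪ U)

/-- Right `G`-principal coverings. -/
structure IsPrincipalCovering (p : E → B) : Prop where
  covering : IsCovering p
  totallyDiscontinuous : IsTotallyDiscontinuous G E
  invariant : ∀ (g : G) (x : E), p (MulOpposite.op g • x) = p x
  transitive : ∀ x y : E, p x = p y → ∃ g : G, MulOpposite.op g • x = y

variable {G}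

theorem IsPrincipalCovering.cont {p : E → B} (hp : IsPrincipalCovering G p) : Cont p :=
  hp.covering.locallyTrivial.1

/-- `V` is a lift, starting at `x`, of the loop `v`. -/
def IsLift (p : E → B) (x : E) (v : CPath (p x) (p x)) (V : unitInterval → E) : Prop :=
  Cont V ∧ V 0 = x ∧ ∀ t, p (V t) = v.toFun t

end Covering

end Cech

namespace Cech

universe u v w

section Neighborhoods

variable {X Y : Type*} [ClosureSpace X] [ClosureSpace Y]

theorem isNhd_subtype {A : Set X} {S : Set A} {x : A} :
    IsNhd S x ↔ IsNhd (Subtype.val '' S ∪ Aᶜ) (x : X) := by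
  have h : (Subtype.val '' S ∪ Aᶜ)ᶜ = Subtype.val '' Sᶜ := by
    ext y
    simp only [compl_union, compl_compl, mem_inter_iff, mem_compl_iff, mem_image, Subtype.exists,
      exists_and_right, exists_eq_right, not_exists]
    exact ⟨fun h => ⟨h.2, h.1 h.2⟩, fun ⟨h, h'⟩ => ⟨fun _ => h', h⟩⟩
  unfold IsNhd
  rw [h]
  rfl

theorem IsNhd.image_val {A : Set X} {S : Set A} {x : A} (hS : IsNhd S x) (hA : IsNhd A (x : X)) :
    IsNhd (Subtype.val '' S) (x : X) :=
  ((isNhd_subtype.1 hS).inter hA).mono fun _ hy => hy.1.resolve_right fun h => h hy.2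

theorem isNhd_prod {N : Set (X × Y)} {z : X × Y} :
    IsNhd N z ↔ ∃ V W, IsNhd V z.1 ∧ IsNhd W z.2 ∧ V ×ˢ W ⊆ N := by
  change ¬ (∀ V W, IsNhd V z.1 → IsNhd W z.2 → ((V ×ˢ W) ∩ Nᶜ).Nonempty) ↔ _
  push Not
  simp only [← sdiff_eq, sdiff_eq_empty]

theorem cont_subtype_val {A : Set X} : Cont (Subtype.val : A → X) := by
  rintro S _ ⟨x, hx, rfl⟩
  exact hx

theorem cont_snd : Cont (Prod.snd : X × Y → Y) :=
  cont_iff_isNhd.2 fun _ W hW => isNhd_prod.2 ⟨univ, W, isNhd_univ _, hW, fun _ h => h.2⟩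

theorem cont_prodMk_right (x : X) : Cont (fun y : Y => (x, y)) := by
  refine cont_iff_isNhd.2 fun y N hN => ?_
  obtain ⟨V, W, hV, hW, h⟩ := isNhd_prod.1 hN
  exact hW.mono fun y' hy' => h ⟨hV.mem, hy'⟩

theorem cont_prodMk_left (y : Y) : Cont (fun x : X => (x, y)) := by
  refine cont_iff_isNhd.2 fun x N hN => ?_
  obtain ⟨V, W, hV, hW, h⟩ := isNhd_prod.1 hN
  exact hV.mono fun x' hx' => h ⟨hx', hW.mem⟩

theorem IsDiscrete.isNhd_singleton (h : IsDiscrete X) (x : X) : IsNhd {x} x := by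
  have h1 : ClosureSpace.cl ({x} : Set X)ᶜ = {x}ᶜ := (h x).1
  unfold IsNhd
  rw [h1, compl_compl]
  rfl

end Neighborhoods

section Sheets

variable {E : Type u} {B : Type v} [ClosureSpace E] [ClosureSpace B] {p : E → B}

/-- The fibre of a trivialization over a non-empty set is discrete. -/
theorem isNhd_singleton_of_trivialization (hd : ∀ b : B, IsDiscrete ↥(p ⁻¹' {b})) {U : Set B}
    {F : Type u} [ClosureSpace F] (φ : ↥(p ⁻¹' U) ≃ ↥U × F) (hφ' : Cont φ.symm)
    (hφp : ∀ e, ((φ e).1 : B) = p e) (b : U) (f : F) : IsNhd {f} f := by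
  have hj : Cont fun f : F => ((φ.symm (b, f)) : E) :=
    cont_subtype_val.comp (hφ'.comp (cont_prodMk_right b))
  have hpj : ∀ f, p (φ.symm (b, f)) = b := fun f => by
    rw [← hφp, φ.apply_symm_apply]
  have h := isNhd_subtype.1 ((hd b).isNhd_singleton ⟨(φ.symm (b, f) : E), hpj f⟩)
  refine (cont_iff_isNhd.1 hj f _ h).mono fun f' hf' => ?_
  rcases hf' with ⟨e, he, hef⟩ | hf'
  · rw [mem_singleton_iff.1 he] at hef
    exact (congrArg Prod.snd (φ.symm.injective (Subtype.ext hef))).symm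
  · exact absurd (hpj f') hf'

/-- Two points of a fibre have neighborhoods lying in sheets which are equal or disjoint. -/
theorem IsCovering.exists_nhds (hp : IsCovering p) {e₁ e₂ : E} (he : p e₁ = p e₂) :
    ∃ N₁ N₂, IsNhd N₁ e₁ ∧ IsNhd N₂ e₂ ∧
      ∀ a ∈ N₁, ∀ c ∈ N₂, p a = p c → (a = c ↔ e₁ = e₂) := by
  obtain ⟨hc, -, 𝒰, h𝒰, ht⟩ := hp.locallyTrivial
  obtain ⟨U, hU, hUn⟩ := h𝒰 (p e₁)
  obtain ⟨F, _, φ, hφ, hφ', hφp⟩ := ht U hU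
  have sheet : ∀ (e : E) (h : IsNhd U (p e)),
      IsNhd (Subtype.val '' {a | (φ a).2 = (φ ⟨e, h.mem⟩).2}) e := fun e h => by
    have h1 : IsNhd (p ⁻¹' U) e := cont_iff_isNhd.1 hc _ _ h
    have h2 := isNhd_singleton_of_trivialization hp.discrete φ hφ' hφp ⟨p e, h.mem⟩
      (φ ⟨e, h.mem⟩).2
    exact (cont_iff_isNhd.1 (cont_snd.comp hφ) ⟨e, h.mem⟩ _ h2).image_val h1
  refine ⟨_, _, sheet e₁ hUn, sheet e₂ (he ▸ hUn), ?_⟩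
  rintro _ ⟨a, ha, rfl⟩ _ ⟨c, hc, rfl⟩ hac
  have key : ∀ a c : ↥(p ⁻¹' U), p a = p c → ((a : E) = c ↔ (φ a).2 = (φ c).2) := fun a c h => by
    rw [← Subtype.ext_iff, ← φ.injective.eq_iff, Prod.ext_iff, Subtype.ext_iff, hφp, hφp]
    exact and_iff_right h
  rw [key a c hac, mem_ofPred_eq.mp ha, mem_ofPred_eq.mp hc]
  exact (key ⟨e₁, _⟩ ⟨e₂, _⟩ he).symm

/-- Every point of the base has a neighborhood with continuous sections through all points. -/
theorem IsCovering.exists_section (hp : IsCovering p) (b : B) :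
    ∃ U, IsNhd U b ∧ ∀ e, p e ∈ U → ∃ σ : U → E, Cont σ ∧ (∀ c, p (σ c) = c) ∧
      ∀ h : p e ∈ U, σ ⟨p e, h⟩ = e := by
  obtain ⟨-, -, 𝒰, h𝒰, ht⟩ := hp.locallyTrivial
  obtain ⟨U, hU, hUn⟩ := h𝒰 b
  obtain ⟨F, _, φ, hφ, hφ', hφp⟩ := ht U hU
  refine ⟨U, hUn, fun e he => ⟨fun c => φ.symm (c, (φ ⟨e, he⟩).2),
    cont_subtype_val.comp (hφ'.comp (cont_prodMk_left _)), fun c => ?_, fun h => ?_⟩⟩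
  · rw [← hφp, φ.apply_symm_apply]
  · have : ((⟨p e, h⟩ : U), (φ ⟨e, he⟩).2) = φ ⟨e, he⟩ :=
      Prod.ext (Subtype.ext (hφp ⟨e, he⟩).symm) rfl
    simp only [this, φ.symm_apply_apply]

end Sheets

section Lifting

variable {E : Type u} {B : Type v} [ClosureSpace E] [ClosureSpace B] {p : E → B}
  {T : Type*} [TopologicalSpace T]

/-- Continuity on a subset of a topological space of a map to a closure space. -/
def TContOn {X : Type*} [ClosureSpace X] (f : T → X) (A : Set T) : Prop :=
  ∀ t ∈ A, ∀ U, IsNhd U (f t) → f ⁻¹' U ∈ 𝓝[A] t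

theorem tcontOn_univ {X : Type*} [ClosureSpace X] {f : T → X} : TContOn f univ ↔ TCont f := by
  simp [TContOn, TCont, nhdsWithin_univ]

theorem TContOn.mono {X : Type*} [ClosureSpace X] {f : T → X} {A C : Set T} (hf : TContOn f C)
    (h : A ⊆ C) : TContOn f A :=
  fun t ht U hU => nhdsWithin_mono t h (hf t (h ht) U hU)

theorem TContOn.congr {X : Type*} [ClosureSpace X] {f g : T → X} {A : Set T} (hf : TContOn f A)
    (h : EqOn g f A) : TContOn g A := by
  intro t ht U hU
  rw [h ht] at hU
  filter_upwards [hf t ht U hU, self_mem_nhdsWithin] with s hs hsA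
  rwa [mem_preimage, h hsA]

theorem TContOn.union {X : Type*} [ClosureSpace X] {f : T → X} {A C : Set T} (hA : IsClosed A)
    (hC : IsClosed C) (hf : TContOn f A) (hg : TContOn f C) : TContOn f (A ∪ C) := by
  intro t _ U hU
  have aux : ∀ D : Set T, IsClosed D → TContOn f D → f ⁻¹' U ∈ 𝓝[D] t := fun D hD h => by
    by_cases ht : t ∈ D
    · exact h t ht U hU
    · rw [notMem_closure_iff_nhdsWithin_eq_bot.1 (by rwa [hD.closure_eq])]
      trivial
  rw [nhdsWithin_union]
  exact ⟨aux A hA hf, aux C hC hg⟩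

/-- Lifts over a preconnected set are determined by their value at one point. -/
theorem IsCovering.eqOn_of_lifts (hp : IsCovering p) {A : Set T} (hA : IsPreconnected A)
    {f g : T → E} (hf : TContOn f A) (hg : TContOn g A) (hfg : ∀ t ∈ A, p (f t) = p (g t))
    {t₀ : T} (ht₀ : t₀ ∈ A) (h₀ : f t₀ = g t₀) : EqOn f g A := by
  have key : ∀ t ∈ A, ∀ᶠ s in 𝓝[A] t, (f s = g s ↔ f t = g t) := fun t ht => by
    obtain ⟨N₁, N₂, h₁, h₂, h⟩ := hp.exists_nhds (hfg t ht)
    filter_upwards [hf t ht _ h₁, hg t ht _ h₂, self_mem_nhdsWithin] with s hs₁ hs₂ hs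
    exact h _ hs₁ _ hs₂ (hfg s hs)
  have := isPreconnected_iff_preconnectedSpace.1 hA
  have hcl : IsLocallyConstant fun s : A => (f s = g s) := by
    refine (IsLocallyConstant.iff_eventually_eq _).2 fun t => ?_
    have := key t t.2
    rw [nhdsWithin_eq_map_subtype_coe t.2, Filter.eventually_map] at this
    exact this.mono fun s hs => propext hs
  intro t ht
  exact (hcl.apply_eq_of_isPreconnected isPreconnected_univ (mem_univ (⟨t, ht⟩ : A))
    (mem_univ ⟨t₀, ht₀⟩)).mpr h₀

/-- The map `h` lifts over `A` through every point over its image. -/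
def Liftable (p : E → B) (h : T → B) (A : Set T) : Prop :=
  ∀ t₀ ∈ A, ∀ e, p e = h t₀ → ∃ f : T → E, TContOn f A ∧ (∀ t ∈ A, p (f t) = h t) ∧ f t₀ = e

theorem Liftable.of_mapsTo {h : T → B} (hh : TCont h) {U : Set B}
    (hU : ∀ e, p e ∈ U → ∃ σ : U → E, Cont σ ∧ (∀ c, p (σ c) = c) ∧
      ∀ h : p e ∈ U, σ ⟨p e, h⟩ = e) {A : Set T} (hA : MapsTo h A U) : Liftable p h A := by
  classical
  intro t₀ ht₀ e he
  obtain ⟨σ, hσ, hσp, hσe⟩ := hU e (he ▸ hA ht₀)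
  refine ⟨fun t => if ht : h t ∈ U then σ ⟨h t, ht⟩ else e, ?_, ?_, ?_⟩
  · intro t ht N hN
    simp only [dif_pos (hA ht)] at hN
    have h1 := isNhd_subtype.1 (cont_iff_isNhd.1 hσ _ _ hN)
    filter_upwards [mem_nhdsWithin_of_mem_nhds (hh t _ h1), self_mem_nhdsWithin] with s hs hsA
    rcases hs with ⟨c, hc, hcs⟩ | hs
    · simp only [mem_preimage, dif_pos (hA hsA)]
      have : c = ⟨h s, hA hsA⟩ := Subtype.ext hcs
      exact this ▸ hc
    · exact absurd (hA hsA) hs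
  · intro t ht
    simp only [dif_pos (hA ht), hσp]
  · simp only [dif_pos (hA ht₀)]
    simp only [← he]
    exact hσe _

theorem Liftable.union (hp : IsCovering p) {h : T → B} {A C : Set T} (hA : IsClosed A)
    (hC : IsClosed C) (hAC : IsConnected (A ∩ C)) (lA : Liftable p h A) (lC : Liftable p h C) :
    Liftable p h (A ∪ C) := by
  classical
  have main : ∀ A C : Set T, IsClosed A → IsClosed C → IsConnected (A ∩ C) → Liftable p h A →
      Liftable p h C → ∀ t₀ ∈ A, ∀ e, p e = h t₀ →
      ∃ f : T → E, TContOn f (A ∪ C) ∧ (∀ t ∈ A ∪ C, p (f t) = h t) ∧ f t₀ = e := by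
    intro A C hA hC hAC lA lC t₀ ht₀ e he
    obtain ⟨f, hf, hfp, hfe⟩ := lA t₀ ht₀ e he
    obtain ⟨t₁, h₁⟩ := hAC.nonempty
    obtain ⟨g, hg, hgp, hge⟩ := lC t₁ h₁.2 (f t₁) (hfp t₁ h₁.1)
    have hfg : EqOn f g (A ∩ C) := hp.eqOn_of_lifts hAC.isPreconnected (hf.mono inter_subset_left)
      (hg.mono inter_subset_right) (fun t ht => (hfp t ht.1).trans (hgp t ht.2).symm) h₁ hge.symm
    have eA : EqOn (A.piecewise f g) f A := piecewise_eqOn A f g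
    have eC : EqOn (A.piecewise f g) g C := fun t ht => by
      by_cases htA : t ∈ A
      · rw [eA htA, hfg ⟨htA, ht⟩]
      · exact piecewise_eq_of_notMem A f g htA
    refine ⟨A.piecewise f g, (hf.congr eA).union hA hC (hg.congr eC), ?_, (eA ht₀).trans hfe⟩
    rintro t (ht | ht)
    · rw [eA ht, hfp t ht]
    · rw [eC ht, hgp t ht]
  rintro t₀ (ht₀ | ht₀) e he
  · exact main A C hA hC hAC lA lC t₀ ht₀ e he
  · rw [union_comm]
    exact main C A hC hA (inter_comm A C ▸ hAC) lC lA t₀ ht₀ e he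

/-- Maps from the unit square lift along coverings. -/
theorem IsCovering.liftable_unitSquare (hp : IsCovering p) {h : unitInterval × unitInterval → B}
    (hh : TCont h) : Liftable p h univ := by
  choose U hU hUσ using hp.exists_section
  obtain ⟨t, ht0, htm, ⟨n, hn⟩, htc⟩ := exists_monotone_Icc_subset_open_cover_unitInterval_prod_self
    (c := fun z => interior (h ⁻¹' U (h z))) (fun _ => isOpen_interior)
    (fun z _ => mem_iUnion.2 ⟨z, mem_interior_iff_mem_nhds.2 (hh z _ (hU _))⟩)
  have box : ∀ i j, Liftable p h (Icc (t i) (t (i + 1)) ×ˢ Icc (t j) (t (j + 1))) := fun i j => by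
    obtain ⟨z, hz⟩ := htc i j
    exact Liftable.of_mapsTo hh (hUσ (h z)) fun s hs =>
      (interior_subset (s := h ⁻¹' U (h z)) (hz hs) :)
  have conn : ∀ a b c d : unitInterval, a ≤ b → c ≤ d → IsConnected (Icc a b ×ˢ Icc c d) :=
    fun a b c d hab hcd => (isConnected_Icc hab).prod (isConnected_Icc hcd)
  have cut : ∀ i, Icc (t 0) (t i) ∩ Icc (t i) (t (i + 1)) = Icc (t i) (t i) := fun i => by
    rw [Icc_inter_Icc, sup_eq_right.2 (htm (Nat.zero_le i)), inf_eq_left.2 (htm i.le_succ)]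
  have row : ∀ j i, Liftable p h (Icc (t 0) (t (i + 1)) ×ˢ Icc (t j) (t (j + 1))) := fun j i => by
    induction i with
    | zero => exact box 0 j
    | succ i ih =>
      rw [← Icc_union_Icc_eq_Icc (htm (Nat.zero_le (i + 1))) (htm (i + 1).le_succ), union_prod]
      refine ih.union hp (isClosed_Icc.prod isClosed_Icc) (isClosed_Icc.prod isClosed_Icc) ?_
        (box (i + 1) j)
      rw [← inter_prod, cut]
      exact conn _ _ _ _ le_rfl (htm j.le_succ)
  have rect : ∀ i j, Liftable p h (Icc (t 0) (t (i + 1)) ×ˢ Icc (t 0) (t (j + 1))) := fun i j => by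
    induction j with
    | zero => exact row 0 i
    | succ j ih =>
      rw [← Icc_union_Icc_eq_Icc (htm (Nat.zero_le (j + 1))) (htm (j + 1).le_succ), prod_union]
      refine ih.union hp (isClosed_Icc.prod isClosed_Icc) (isClosed_Icc.prod isClosed_Icc) ?_
        (row (j + 1) i)
      rw [← prod_inter, cut]
      exact conn _ _ _ _ (htm (Nat.zero_le _)) le_rfl
  have hI : Icc (t 0) (t (n + 1)) = univ := by
    rw [ht0, hn (n + 1) n.le_succ]
    exact eq_univ_of_forall fun s => ⟨s.2.1, s.2.2⟩
  simpa only [hI, univ_prod_univ] using rect n n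

theorem IsCovering.eq_of_lifts (hp : IsCovering p) [PreconnectedSpace T] {f g : T → E}
    (hf : TCont f) (hg : TCont g) (hfg : ∀ t, p (f t) = p (g t)) {t₀ : T} (h₀ : f t₀ = g t₀) :
    f = g :=
  funext fun t => hp.eqOn_of_lifts isPreconnected_univ (tcontOn_univ.2 hf) (tcontOn_univ.2 hg)
    (fun t _ => hfg t) (mem_univ t₀) h₀ (mem_univ t)

theorem IsCovering.exists_lift_unitSquare (hp : IsCovering p) {h : unitInterval × unitInterval → B}
    (hh : TCont h) {e : E} (he : p e = h 0) :
    ∃ f, TCont f ∧ (∀ z, p (f z) = h z) ∧ f 0 = e := by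
  obtain ⟨f, hf, hfp, hfe⟩ := hp.liftable_unitSquare hh 0 (mem_univ _) e he
  exact ⟨f, tcontOn_univ.1 hf, fun z => hfp z (mem_univ z), hfe⟩

theorem IsCovering.exists_lift_unitInterval (hp : IsCovering p) {h : unitInterval → B}
    (hh : TCont h) {e : E} (he : p e = h 0) : ∃ f, TCont f ∧ (∀ t, p (f t) = h t) ∧ f 0 = e := by
  obtain ⟨f, hf, hfp, hfe⟩ := hp.exists_lift_unitSquare (hh.comp continuous_fst) he
  exact ⟨fun t => f (t, 0), hf.comp (by fun_prop), fun t => hfp _, hfe⟩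

/-- Two paths in the total space with the same source and with homotopic projections have the same
target and are homotopic. -/
theorem IsCovering.exists_lift_homotopy (hp : IsCovering p) {V W : unitInterval → E}
    (hV : TCont V) (hW : TCont W) (h0 : V 0 = W 0) {H : unitInterval × unitInterval → B}
    (hH : TCont H) (H0 : ∀ s, H (s, 0) = p (V s)) (H1 : ∀ s, H (s, 1) = p (W s))
    (Hl : ∀ t, H (0, t) = p (V 0)) (Hr : ∀ t, H (1, t) = p (V 1)) :
    ∃ K : unitInterval × unitInterval → E, TCont K ∧ (∀ s, K (s, 0) = V s) ∧
      (∀ s, K (s, 1) = W s) ∧ (∀ t, K (0, t) = V 0) ∧ ∀ t, K (1, t) = V 1 := by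
  obtain ⟨K, hK, hKp, hK0⟩ := hp.exists_lift_unitSquare hH (e := V 0) (H0 0).symm
  have e0 : (fun s => K (s, 0)) = V :=
    hp.eq_of_lifts (hK.comp (by fun_prop)) hV (fun s => (hKp _).trans (H0 s)) (t₀ := 0) hK0
  have el : (fun t => K (0, t)) = fun _ => V 0 :=
    hp.eq_of_lifts (hK.comp (by fun_prop)) (tcont_const _) (fun s => (hKp _).trans (Hl s))
      (t₀ := 0) hK0
  have er : (fun t => K (1, t)) = fun _ => V 1 :=
    hp.eq_of_lifts (hK.comp (by fun_prop)) (tcont_const _) (fun s => (hKp _).trans (Hr s))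
      (t₀ := 0) (congrFun e0 1)
  have e1 : (fun s => K (s, 1)) = W :=
    hp.eq_of_lifts (hK.comp (by fun_prop)) hW (fun s => (hKp _).trans (H1 s)) (t₀ := 0)
      ((congrFun el 1).trans h0)
  exact ⟨K, hK, congrFun e0, congrFun e1, congrFun el, congrFun er⟩

end Lifting

section Principal

variable {E : Type u} {B : Type v} {G : Type w} [ClosureSpace E] [ClosureSpace B] [Group G]
  [MulAction Gᵐᵒᵖ E] {p : E → B}

theorem IsCovering.exists_isLift (hp : IsCovering p) (x : E) (v : CPath (p x) (p x)) :
    ∃ V, IsLift p x v V := by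
  obtain ⟨V, hV, hVp, hV0⟩ := hp.exists_lift_unitInterval (cont_unitInterval.1 v.cont)
    v.source.symm
  exact ⟨V, cont_unitInterval.2 hV, hV0, hVp⟩

theorem IsCovering.isLift_unique (hp : IsCovering p) {x : E} {v : CPath (p x) (p x)}
    {V W : unitInterval → E} (hV : IsLift p x v V) (hW : IsLift p x v W) : V = W :=
  hp.eq_of_lifts (cont_unitInterval.1 hV.1) (cont_unitInterval.1 hW.1)
    (fun t => (hV.2.2 t).trans (hW.2.2 t).symm) (hV.2.1.trans hW.2.1.symm)

theorem IsLift.homotopy (hp : IsCovering p) {x : E} {v w : CPath (p x) (p x)}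
    {V W : unitInterval → E} (hV : IsLift p x v V) (hW : IsLift p x w W)
    (h : CPath.Homotopic v w) :
    ∃ K : unitInterval × unitInterval → E, TCont K ∧ (∀ s, K (s, 0) = V s) ∧
      (∀ s, K (s, 1) = W s) ∧ (∀ t, K (0, t) = V 0) ∧ ∀ t, K (1, t) = V 1 := by
  obtain ⟨H, hH, H0, H1, Hl, Hr⟩ := h
  exact hp.exists_lift_homotopy (cont_unitInterval.1 hV.1) (cont_unitInterval.1 hW.1)
    (hV.2.1.trans hW.2.1.symm) (cont_unitSquare.1 hH) (fun s => (H0 s).trans (hV.2.2 s).symm)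
    (fun s => (H1 s).trans (hW.2.2 s).symm) (fun t => by rw [Hl, hV.2.1])
    (fun t => by rw [Hr, hV.2.2, v.target])

theorem IsLift.target_eq (hp : IsCovering p) {x : E} {v w : CPath (p x) (p x)}
    {V W : unitInterval → E} (hV : IsLift p x v V) (hW : IsLift p x w W)
    (h : CPath.Homotopic v w) : V 1 = W 1 := by
  obtain ⟨K, -, -, K1, -, Kr⟩ := hV.homotopy hp hW h
  rw [← Kr 1, K1]

theorem CPath.isLift_map (hc : Cont p) {x : E} (f : CPath x x) :
    IsLift p x (f.map p hc) f.toFun :=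
  ⟨f.cont, f.source, fun _ => rfl⟩

theorem IsCovering.fundGroupMap_injective (hp : IsCovering p) (hc : Cont p) (x : E) :
    Function.Injective (FundGroup.map p hc x) := by
  rintro ⟨f⟩ ⟨g⟩ h
  obtain ⟨K, hK, K0, K1, Kl, Kr⟩ :=
    (f.isLift_map hc).homotopy hp (g.isLift_map hc) (Quotient.exact h)
  exact Quotient.sound ⟨K, cont_unitSquare.2 hK, K0, K1, fun t => (Kl t).trans f.source,
    fun t => (Kr t).trans f.target⟩

theorem IsTotallyDiscontinuous.eq_one_of_smul_eq (h : IsTotallyDiscontinuous G E) {x : E} {g : G}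
    (hg : MulOpposite.op g • x = x) : g = 1 := by
  by_contra hne
  obtain ⟨U, hU, h'⟩ := h.exists_nhd x
  exact ((h' g hne).1.subset ⟨⟨x, hU.mem, hg⟩, hU.mem⟩ :)

theorem IsTotallyDiscontinuous.smul_injective (h : IsTotallyDiscontinuous G E) (x : E) :
    Function.Injective fun g : G => MulOpposite.op g • x := by
  intro a b hab
  refine mul_inv_eq_one.1 (h.eq_one_of_smul_eq (x := x) ?_)
  rw [MulOpposite.op_mul, mul_smul, show MulOpposite.op a • x = MulOpposite.op b • x from hab,
    ← mul_smul, ← MulOpposite.op_mul, mul_inv_cancel, MulOpposite.op_one, one_smul]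

theorem IsLift.trans (hp : IsPrincipalCovering G p) {x : E} {v w : CPath (p x) (p x)}
    {V W : unitInterval → E} (hV : IsLift p x v V) (hW : IsLift p x w W) {a : G}
    (ha : V 1 = MulOpposite.op a • x) :
    ∃ Z, IsLift p x (v.trans w) Z ∧ Z 1 = MulOpposite.op a • W 1 := by
  let V' : CPath x (MulOpposite.op a • x) := ⟨V, hV.1, hV.2.1, ha⟩
  let W' : CPath x (W 1) := ⟨W, hW.1, hW.2.1, rfl⟩
  let Z := V'.trans (W'.map _ (hp.totallyDiscontinuous.cont a))
  refine ⟨Z.toFun, ⟨Z.cont, Z.source, fun t => ?_⟩, Z.target⟩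
  rcases le_total (t : ℝ) (1 / 2) with h | h
  · rw [CPath.trans_of_le _ _ h, CPath.trans_of_le _ _ h]
    exact hV.2.2 _
  · rw [CPath.trans_of_ge _ _ h, CPath.trans_of_ge _ _ h]
    exact (hp.invariant a _).trans (hW.2.2 _)

theorem IsPrincipalCovering.exists_monodromy (hp : IsPrincipalCovering G p) (x : E) :
    ∃ Γ : FundGroup B (p x) →* G, ∀ v V, IsLift p x v V →
      V 1 = MulOpposite.op (Γ (FundGroup.mk v))⁻¹ • x := by
  choose V hV using hp.covering.exists_isLift x
  have hg : ∀ v, ∃ g : G, MulOpposite.op g⁻¹ • x = V v 1 := fun v => by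
    obtain ⟨g, hg⟩ := hp.transitive x (V v 1) (by rw [(hV v).2.2, v.target])
    exact ⟨g⁻¹, by rwa [inv_inv]⟩
  choose γ hγ using hg
  have inj : ∀ {a b : G}, MulOpposite.op a⁻¹ • x = MulOpposite.op b⁻¹ • x → a = b := fun h =>
    inv_injective (hp.totallyDiscontinuous.smul_injective x h)
  refine ⟨MonoidHom.mk' (Quotient.lift γ fun v w h => inj ?_) ?_, fun v W hW => ?_⟩
  · rw [hγ, hγ]
    exact (hV v).target_eq hp.covering (hV w) h
  · rintro ⟨v⟩ ⟨w⟩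
    refine inj (((hγ _).trans ?_ : MulOpposite.op (γ (v.trans w))⁻¹ • x = _))
    obtain ⟨Z, hZ, hZ1⟩ := (hV v).trans hp (hV w) (hγ v).symm
    rw [hp.covering.isLift_unique (hV _) hZ, hZ1, ← hγ w, ← mul_smul, ← MulOpposite.op_mul,
      ← mul_inv_rev]
  · rw [hp.covering.isLift_unique hW (hV v), ← hγ]
    rfl

theorem PathConn.subsingleton_fundGroup {X : Type*} [ClosureSpace X] (hX : PathConn X) {x : X}
    (h : Subsingleton (FundGroup X x)) (y : X) : Subsingleton (FundGroup X y) := by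
  obtain ⟨q⟩ := hX.2 x y
  refine subsingleton_of_forall_eq 1 ?_
  rintro ⟨f⟩
  refine Quotient.sound ?_
  have h1 : CPath.Homotopic ((q.trans f).trans q.symm) (CPath.refl x) :=
    Quotient.exact (h.elim (FundGroup.mk _) (FundGroup.mk _))
  have h2 : CPath.Homotopic (q.trans f) q :=
    (CPath.homotopic_trans_refl _).symm.trans <|
      ((CPath.Homotopic.refl _).concat q.homotopic_symm_trans.symm).trans <|
      (CPath.homotopic_assoc _ _ _).symm.trans <|
      (h1.concat (.refl q)).trans q.homotopic_refl_trans
  exact f.homotopic_refl_trans.symm.trans <|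
    (q.homotopic_symm_trans.symm.concat (.refl f)).trans <|
    (CPath.homotopic_assoc _ _ _).trans <|
    ((CPath.Homotopic.refl _).concat h2).trans q.homotopic_symm_trans

theorem IsPrincipalCovering.range_fundGroupMap (hp : IsPrincipalCovering G p) {x : E}
    {Γ : FundGroup B (p x) →* G}
    (hΓ : ∀ v V, IsLift p x v V → V 1 = MulOpposite.op (Γ (FundGroup.mk v))⁻¹ • x) :
    (FundGroup.map p hp.cont x).range = Γ.ker := by
  ext c
  rw [MonoidHom.mem_range, MonoidHom.mem_ker]
  constructor
  · rintro ⟨⟨f⟩, rfl⟩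
    exact inv_eq_one.1 (hp.totallyDiscontinuous.eq_one_of_smul_eq
      ((hΓ _ _ (f.isLift_map hp.cont)).symm.trans f.target))
  · obtain ⟨v⟩ := c
    intro h
    obtain ⟨V, hV⟩ := hp.covering.exists_isLift x v
    have hV1 : V 1 = x := by
      rw [hΓ v V hV, show Γ (FundGroup.mk v) = 1 from h, inv_one, MulOpposite.op_one, one_smul]
    refine ⟨FundGroup.mk ⟨V, hV.1, hV.2.1, hV1⟩, congrArg FundGroup.mk ?_⟩
    obtain ⟨v, _, _, _⟩ := v
    simp only [CPath.map, CPath.mk.injEq]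
    exact funext hV.2.2

theorem IsPrincipalCovering.monodromy_surjective (hp : IsPrincipalCovering G p) (hE : PathConn E)
    {x : E} {Γ : FundGroup B (p x) →* G}
    (hΓ : ∀ v V, IsLift p x v V → V 1 = MulOpposite.op (Γ (FundGroup.mk v))⁻¹ • x) :
    Function.Surjective Γ := by
  intro g
  obtain ⟨q⟩ := hE.2 x (MulOpposite.op g⁻¹ • x)
  let v : CPath (p x) (p x) :=
    ⟨fun t => p (q.toFun t), hp.cont.comp q.cont, by rw [q.source],
      by rw [q.target, hp.invariant]⟩
  refine ⟨FundGroup.mk v, inv_injective (hp.totallyDiscontinuous.smul_injective x ?_)⟩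
  exact (hΓ v q.toFun ⟨q.cont, q.source, fun _ => rfl⟩).symm.trans q.target

theorem IsPrincipalCovering.simplyConn_iff (hp : IsPrincipalCovering G p) (hE : PathConn E)
    {x : E} {Γ : FundGroup B (p x) →* G}
    (hΓ : ∀ v V, IsLift p x v V → V 1 = MulOpposite.op (Γ (FundGroup.mk v))⁻¹ • x) :
    SimplyConn E ↔ Function.Bijective Γ := by
  have hsub : Subsingleton (FundGroup E x) ↔ Function.Injective Γ := by
    rw [← MonoidHom.ker_eq_bot_iff, ← hp.range_fundGroupMap hΓ]
    constructor
    · intro h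
      refine (Subgroup.eq_bot_iff_forall _).2 ?_
      rintro _ ⟨f, rfl⟩
      rw [Subsingleton.elim f 1, map_one]
    · refine fun h => subsingleton_of_forall_eq 1 fun f => ?_
      refine hp.covering.fundGroupMap_injective hp.cont x ?_
      rw [map_one]
      exact (Subgroup.eq_bot_iff_forall _).1 h _ ⟨f, rfl⟩
  exact ⟨fun h => ⟨hsub.1 (h.2 x), hp.monodromy_surjective hE hΓ⟩,
    fun h => ⟨hE, fun y => hE.subsingleton_fundGroup (hsub.2 h.1) y⟩⟩

end Principal

end Cech

theorem mainTheorem8 {E B G : Type*} [Cech.ClosureSpace E] [Cech.ClosureSpace B] [Group G]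
    [MulAction Gᵐᵒᵖ E] (p : E → B) (hp : Cech.IsPrincipalCovering G p) (hE : Cech.PathConn E) :
    (∀ x : E, ∃ Γ : Cech.FundGroup B (p x) →* G,
      -- each loop `v` at `p x` has a unique lift starting at `x`; it ends at `x · Γ [v]⁻¹`
      (∀ v : Cech.CPath (p x) (p x), ∃ V : unitInterval → E,
        Cech.IsLift p x v V ∧ (∀ W, Cech.IsLift p x v W → W = V) ∧
          V 1 = MulOpposite.op (Γ (Cech.FundGroup.mk v))⁻¹ • x) ∧
      -- exactness of the sequence
      Function.Injective (Cech.FundGroup.map p hp.cont x) ∧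
      (Cech.FundGroup.map p hp.cont x).range = Γ.ker ∧
      Function.Surjective Γ ∧
      -- normality of the image
      (Cech.FundGroup.map p hp.cont x).range.Normal ∧
      (Cech.SimplyConn E ↔ Function.Bijective Γ)) ∧
    (Cech.SimplyConn E → ∀ b : B, Nonempty (Cech.FundGroup B b ≃* G)) := by
  refine ⟨fun x => ?_, fun h b => ?_⟩
  · obtain ⟨Γ, hΓ⟩ := hp.exists_monodromy x
    have hr := hp.range_fundGroupMap hΓ
    refine ⟨Γ, fun v => ?_, hp.covering.fundGroupMap_injective hp.cont x, hr,
      hp.monodromy_surjective hE hΓ, hr ▸ Γ.normal_ker, hp.simplyConn_iff hE hΓ⟩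
    obtain ⟨V, hV⟩ := hp.covering.exists_isLift x v
    exact ⟨V, hV, fun W hW => hp.covering.isLift_unique hW hV, hΓ v V hV⟩
  · obtain ⟨x, rfl⟩ := hp.covering.locallyTrivial.2.1 b
    obtain ⟨Γ, hΓ⟩ := hp.exists_monodromy x
    exact ⟨MulEquiv.ofBijective Γ ((hp.simplyConn_iff hE hΓ).1 h)⟩
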